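/- Let $D$ be an oriented diagram, with $N\ge 1$ crossings, of a knot $K$ in $S^3$, let $m_l$ be the Wirtinger generator of the knot group $G_K$ that belongs to the arc $l$ of $D$, and for $a=(x,y)^T\in\mathbb C^2$ put $$M(a)=\begin{pmatrix}1-xy & x^2\\ -y^2 & 1+xy\end{pmatrix}\in SL_2(\mathbb C),\qquad \langle a,b\rangle=\det(a\;b).$$ Let $X_{\rm par}$ be the set of parabolic representations $\rho:G_K\to SL_2(\mathbb C)$ (that is, $\operatorname{tr}\rho(m_l)=2$ for all arcs $l$, and $\rho(m_k)\ne\rho(m_l)$ for some arcs $k,l$), where two representations with the same character are identified; its coordinate ring is the algebra of functions $X_{\rm par}\to\mathbb C$ generated by the traces $\rho\mapsto\operatorname{tr}\rho(g)$, $g\in G_K$. For $\varepsilon\in\{\pm1\}^N$, an arc-coloring of sign-type $\varepsilon$ is a family $(a_l)$ of vectors in $\mathbb C^2$, one for each arc, such that $m_l\mapsto M(a_l)$ defines a parabolic representation, and such that at every crossing $c$, with incoming under-arc $i$, outgoing under-arc $j$ and over-arc $k$, one has $\varepsilon_c\,a_j=M(a_k)^{-1}a_i$ if $c$ is positive, and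 $\varepsilon_c\,a_j=M(a_k)\,a_i$ if $c$ is negative. Fix a sign-type $\varepsilon=(\varepsilon_+,\varepsilon_-)$, that is, two elements $\varepsilon_+,\varepsilon_-\in\{\pm1\}^N$ for which the product of all entries is $+1$ and $-1$, respectively; an arc-coloring of sign-type $\varepsilon$ is one of sign-type $\varepsilon_+$ or $\varepsilon_-$. Assume that $X_{\rm par}$ is zero-dimensional (its coordinate ring has Krull dimension at most $0$; $X_{\rm par}$ may be empty). Then $X_{\rm par}$ is finite, and for any two arcs $i,j$ of $D$ the following hold. Every $\chi\in X_{\rm par}$ is the class of the representation $m_l\mapsto M(a_l)$ for some arc-coloring $a$ of sign-type $\varepsilon$, and the number $u_{ij}^{\varepsilon}(\chi)=\langle a_i,a_j\rangle$ does not depend on the choice of $a$. The $u$-polynomial $$g_{ij}(u)=\prod_{\chi\in X_{\rm par}}\bigl(u-u_{ij}^{\varepsilon}(\chi)\bigr)$$ has rational coefficients. -/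

import Mathlib

/-- A signed oriented Gauss diagram with `n` crossings. A *passage* `(c, o)` is one of the two
times the curve runs through the crossing `c`: over it if `o = true`, under it if `o = false`.
`next p` is the passage that follows `p` along the orientation, and `sign c` is the sign of the
crossing `c`. The edge of the underlying four-valent graph from `p` to `next p` is also named
`p`, so that the edge arriving at the passage `p` is `next.symm p`. -/
structure GaussDiagram where
  n : ℕ
  next : Equiv.Perm (Fin n × Bool)
  sign : Fin n → ℤˣ

namespace GaussDiagram

variable (D : GaussDiagram)

/-- Half-edges: `(p, true)` leaves the passage `p`, and `(p, false)` arrives at it. -/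
abbrev HalfEdge : Type := (Fin D.n × Bool) × Bool

/-- The other half of the same edge. -/
def flip : D.HalfEdge → D.HalfEdge
  | (p, true) => (D.next p, false)
  | (p, false) => (D.next.symm p, true)

/-- The next half-edge counterclockwise around the same crossing. At a positive crossing the order
is over-out, under-out, over-in, under-in; at a negative crossing it is over-out, under-in,
over-in, under-out. -/
def rot : D.HalfEdge → D.HalfEdge
  | ((c, o), d) => ((c, !o), if (o = true ↔ D.sign c = 1) then d else !d)

/-- The faces of the surface on which the diagram is drawn: the orbits of `rot ∘ flip`. -/
def Face : Type := Quot fun h h' : D.HalfEdge => h' = D.rot (D.flip h)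

end GaussDiagram

/-- An oriented knot diagram with at least one crossing, on the sphere: a signed Gauss diagram
with exactly one component whose surface has Euler characteristic
`n - 2 * n + #faces = 2`. -/
structure KnotDiagram extends GaussDiagram where
  one_component : ∀ p q, next.SameCycle p q
  planar : Nat.card toGaussDiagram.Face = n + 2

/-- The group `SL(2, ℂ)`. -/
abbrev SL2C : Type := Matrix.SpecialLinearGroup (Fin 2) ℂ

/-- The parabolic quandle map, `(x, y) ↦ !![1 - x * y, x ^ 2; -y ^ 2, 1 + x * y]`. -/
def quandleMap (a : Fin 2 → ℂ) : SL2C :=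
  ⟨!![1 - a 0 * a 1, a 0 ^ 2; -a 1 ^ 2, 1 + a 0 * a 1], by
    rw [Matrix.det_fin_two_of]; ring⟩

/-- The quandle operation `a ▷ b = M(b)⁻¹ a`. -/
def qr (a b : Fin 2 → ℂ) : Fin 2 → ℂ :=
  ((quandleMap b)⁻¹ : SL2C).1.mulVec a

/-- The inverse quandle operation `a ◁ b = M(b) a`. -/
def ql (a b : Fin 2 → ℂ) : Fin 2 → ℂ :=
  (quandleMap b).1.mulVec a

/-- The determinant `⟨a, b⟩` of the matrix with columns `a`, `b`. -/
def bracket (a b : Fin 2 → ℂ) : ℂ :=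
  Matrix.det !![a 0, b 0; a 1, b 1]

namespace KnotDiagram

variable (D : KnotDiagram)

/-- The arcs of the diagram: maximal chains of edges that are joined at over-passages. -/
def Arc : Type :=
  Quot fun e e' : Fin D.n × Bool => ∃ c, e = D.next.symm (c, true) ∧ e' = (c, true)

/-- The incoming under-arc at a crossing. -/
def inArc (c : Fin D.n) : D.Arc := Quot.mk _ (D.next.symm (c, false))

/-- The outgoing under-arc at a crossing. -/
def outArc (c : Fin D.n) : D.Arc := Quot.mk _ (c, false)

/-- The over-arc at a crossing. -/
def overArc (c : Fin D.n) : D.Arc := Quot.mk _ (c, true)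

/-- The Wirtinger relator: with `i`, `j`, `k` the incoming arc, the outgoing arc and the over-arc,
it is `j⁻¹ k⁻¹ i k` at a positive crossing and `j⁻¹ k i k⁻¹` at a negative one. -/
def relator (c : Fin D.n) : FreeGroup D.Arc :=
  (FreeGroup.of (D.outArc c))⁻¹ * FreeGroup.of (D.overArc c) ^ (-(D.sign c : ℤ)) *
    FreeGroup.of (D.inArc c) * FreeGroup.of (D.overArc c) ^ (D.sign c : ℤ)

/-- The knot group, in its Wirtinger presentation. -/
abbrev KnotGroup : Type := PresentedGroup (Set.range D.relator)

/-- The meridian of an arc. -/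
def meridian (i : D.Arc) : D.KnotGroup := PresentedGroup.of i

/-- The parabolic (in particular non-abelian) representations of the knot group. -/
def Rpar : Type :=
  {ρ : D.KnotGroup →* SL2C //
    (∀ i, (ρ (D.meridian i)).1.trace = 2) ∧ ∃ i j, ρ (D.meridian i) ≠ ρ (D.meridian j)}

/-- Two representations are identified if they have the same character. -/
instance charSetoid : Setoid D.Rpar where
  r ρ ρ' := ∀ g, (ρ.1 g).1.trace = (ρ'.1 g).1.trace
  iseqv := ⟨fun _ _ => rfl, fun h g => (h g).symm, fun h h' g => (h g).trans (h' g)⟩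

/-- The character variety of parabolic representations, as a set. -/
def Xpar : Type := Quotient D.charSetoid

/-- The function `χ ↦ tr ρ(g)` on the character variety, where `χ` is the class of `ρ`. -/
def traceFun (g : D.KnotGroup) : D.Xpar → ℂ :=
  Quotient.lift (fun ρ : D.Rpar => (ρ.1 g).1.trace) fun _ _ h => h g

/-- The coordinate ring of the character variety: the algebra of functions on it that is
generated by the traces of the elements of the knot group. -/
def coordinateRing : Subalgebra ℂ (D.Xpar → ℂ) :=
  Algebra.adjoin ℂ (Set.range D.traceFun)

/-- `X_par` has no component of positive dimension (it may be empty, as for the unknot). -/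
def XparZeroDimensional : Prop := ringKrullDim D.coordinateRing ≤ 0

/-- The coloring `a` of the arcs by vectors represents the point `χ` of `X_par`: its associated
representation, `meridian i ↦ quandleMap (a i)`, is parabolic with class `χ`. -/
def Represents (a : D.Arc → Fin 2 → ℂ) (χ : D.Xpar) : Prop :=
  ∃ ρ : D.Rpar, Quotient.mk D.charSetoid ρ = χ ∧ ∀ i, ρ.1 (D.meridian i) = quandleMap (a i)

/-- The parabolic quandle system (with sign ambiguity): the colorings whose associated
representation is parabolic. -/
def quandleSystem : Set (D.Arc → Fin 2 → ℂ) := {a | ∃ χ, D.Represents a χ}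

/-- The parabolic quandle system with sign-type `ε`: the arc-colorings in the quandle system with
`ε c • a_j = a_i ▷ a_k` at a positive crossing and `ε c • a_j = a_i ◁ a_k` at a negative one, where
`i`, `j`, `k` are the incoming arc, the outgoing arc and the over-arc. -/
def signedQuandleSystem (ε : Fin D.n → ℤˣ) : Set (D.Arc → Fin 2 → ℂ) :=
  {a | a ∈ D.quandleSystem ∧ ∀ c, (((ε c : ℤˣ) : ℤ) : ℂ) • a (D.outArc c) =
    if D.sign c = 1 then qr (a (D.inArc c)) (a (D.overArc c))
    else ql (a (D.inArc c)) (a (D.overArc c))}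

/-- A sign-type for all parabolic representations: one sign-type for each of the two possible
values of the total sign. -/
structure SignTypePair where
  pos : Fin D.n → ℤˣ
  neg : Fin D.n → ℤˣ
  prod_pos : ∏ c, pos c = 1
  prod_neg : ∏ c, neg c = -1

/-- The arc-colorings of sign-type `ε = (ε₊, ε₋)`. -/
def coloringsOfType (ε : D.SignTypePair) : Set (D.Arc → Fin 2 → ℂ) :=
  D.signedQuandleSystem ε.pos ∪ D.signedQuandleSystem ε.neg

open Classical in
/-- The `u`-value at the arcs `i`, `j`: the number `⟨a i, a j⟩`, where `a` is an arc-coloring of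
sign-type `ε` that represents `χ`. -/
noncomputable def uValue (ε : D.SignTypePair) (i j : D.Arc) (χ : D.Xpar) : ℂ :=
  if h : ∃ a ∈ D.coloringsOfType ε, D.Represents a χ then
    bracket (h.choose i) (h.choose j)
  else 0

/-- The `u`-polynomial at the arcs `i`, `j`: the product of `u - u_ij(χ)` over all `χ` in `X_par`
(meaningful if `X_par` is finite). -/
noncomputable def uPolynomial (ε : D.SignTypePair) (i j : D.Arc) : Polynomial ℂ :=
  ∏ᶠ χ : D.Xpar, (Polynomial.X - Polynomial.C (D.uValue ε i j χ))

end KnotDiagram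

/-! Three arguments combine. Well-definedness: `M` is equivariant, maps onto the matrices of trace
2, and has fibres `{a, -a}`, so the colorings of one representation differ by a sign on each arc.
Such a change alters the sign-type by a coboundary along the knot. Since the knot is a single cycle,
only the total sign survives: exactly one of `ε₊`, `ε₋` occurs for a given representation, and its
coloring is unique up to one common sign, which the bracket ignores
(`exists_colors_mem_coloringsOfType`, `Colors.exists_sign_of_mem`). Equal characters mean conjugate
representations (`exists_conj_of_charSetoid`), and brackets are `SL(2, ℂ)`-invariant. Finiteness:
the matrices `M(a) - 1` are singular, so traces of words in them reduce to words without repetition,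
and the coordinate ring is finitely generated (`coordinateRing_fg`). In dimension at most 0 it is
Artinian, with finitely many primes, and the points of `X_par` inject into these (`finite_Xpar`).
Rationality: everything is defined over `ℤ`, so automorphisms of `ℂ` permute `X_par` and its
`u`-values compatibly (`uValue_map`). The coefficients of the product are thus fixed by all
automorphisms, hence rational. -/

/-! ### Linear algebra of the parabolic quandle map -/

theorem coe_quandleMap (a : Fin 2 → ℂ) : (quandleMap a).1 =
    !![1 - a 0 * a 1, a 0 ^ 2; -a 1 ^ 2, 1 + a 0 * a 1] := rfl

theorem quandleMap_mulVec (g : SL2C) (a : Fin 2 → ℂ) :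
    quandleMap (g.1.mulVec a) = g * quandleMap a * g⁻¹ := by
  have hg := g.2
  rw [Matrix.det_fin_two] at hg
  ext i j
  fin_cases i <;> fin_cases j <;>
    simp [coe_quandleMap, Matrix.SpecialLinearGroup.coe_mul, Matrix.mul_apply, Fin.sum_univ_two,
      Matrix.SpecialLinearGroup.coe_inv, Matrix.adjugate_fin_two]
  · linear_combination -hg
  · ring
  · ring
  · linear_combination -hg

theorem quandleMap_eq_iff {a b : Fin 2 → ℂ} :
    quandleMap a = quandleMap b ↔ b = a ∨ b = -a := by
  constructor
  · intro h
    have h01 := congrArg (fun g : SL2C => g.1 0 1) h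
    have h10 := congrArg (fun g : SL2C => g.1 1 0) h
    have h11 := congrArg (fun g : SL2C => g.1 1 1) h
    simp only [quandleMap, Matrix.of_apply, Matrix.cons_val', Matrix.cons_val_zero,
      Matrix.cons_val_one, Matrix.cons_val_fin_one, neg_inj, add_right_inj] at h01 h10 h11
    have e0 := sq_eq_sq_iff_eq_or_eq_neg.1 h01.symm
    have e1 := sq_eq_sq_iff_eq_or_eq_neg.1 h10.symm
    have ext2 : ∀ {u v : Fin 2 → ℂ}, u 0 = v 0 → u 1 = v 1 → u = v := fun h h' => by
      ext i; fin_cases i <;> assumption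
    rcases e0 with e0 | e0 <;> rcases e1 with e1 | e1
    · exact Or.inl (ext2 e0 e1)
    · rw [e0, e1] at h11
      rcases mul_eq_zero.1 (show a 0 * a 1 = 0 by linear_combination h11 / 2) with h | h
      · exact Or.inr (ext2 (by simp [e0, h]) (by simp [e1]))
      · exact Or.inl (ext2 e0 (by simp [e1, h]))
    · rw [e0, e1] at h11
      rcases mul_eq_zero.1 (show a 0 * a 1 = 0 by linear_combination h11 / 2) with h | h
      · exact Or.inl (ext2 (by simp [e0, h]) e1)
      · exact Or.inr (ext2 (by simp [e0]) (by simp [e1, h]))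
    · exact Or.inr (ext2 (by simp [e0]) (by simp [e1]))
  · rintro (rfl | rfl)
    · rfl
    · ext i j
      fin_cases i <;> fin_cases j <;> simp [quandleMap]

theorem quandleMap_zero : quandleMap 0 = 1 := by
  ext i j
  fin_cases i <;> fin_cases j <;> simp [quandleMap]

theorem quandleMap_units_smul (s : ℤˣ) (a : Fin 2 → ℂ) :
    quandleMap (((s : ℤ) : ℂ) • a) = quandleMap a := by
  refine (quandleMap_eq_iff.2 ?_).symm
  rcases Int.units_eq_one_or s with rfl | rfl <;> simp

theorem exists_quandleMap_eq (A : SL2C) (hA : A.1.trace = 2) : ∃ a, quandleMap a = A := by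
  have hd := A.2
  rw [Matrix.det_fin_two] at hd
  rw [Matrix.trace_fin_two] at hA
  obtain ⟨x, hx⟩ := IsAlgClosed.exists_pow_nat_eq (A.1 0 1) two_pos
  obtain ⟨y, hy⟩ := IsAlgClosed.exists_pow_nat_eq (-A.1 1 0) two_pos
  have hxy : (x * y) ^ 2 = (1 - A.1 0 0) ^ 2 := by
    linear_combination y ^ 2 * hx + A.1 0 1 * hy - A.1 0 0 * hA + hd
  -- The square roots `x`, `y` of the off-diagonal entries are only fixed up to sign; determinant
  -- and trace give `x * y = ±(1 - A 0 0)`, so `y` or `-y` works.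
  have key : ∀ z : ℂ, z ^ 2 = y ^ 2 → x * z = 1 - A.1 0 0 → ∃ a, quandleMap a = A := by
    intro z hz h
    refine ⟨![x, z], ?_⟩
    ext i j
    fin_cases i <;> fin_cases j <;> simp [quandleMap]
    · linear_combination -h
    · exact hx
    · linear_combination -hz - hy
    · linear_combination h - hA
  rcases sq_eq_sq_iff_eq_or_eq_neg.1 hxy with h | h
  · exact key y rfl h
  · exact key (-y) (by ring) (by linear_combination -h)

theorem bracket_eq (a b : Fin 2 → ℂ) : bracket a b = a 0 * b 1 - a 1 * b 0 := by
  rw [bracket, Matrix.det_fin_two_of]; ring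

theorem bracket_mulVec (g : SL2C) (a b : Fin 2 → ℂ) :
    bracket (g.1.mulVec a) (g.1.mulVec b) = bracket a b := by
  have hg := g.2
  rw [Matrix.det_fin_two] at hg
  simp only [bracket_eq, Matrix.mulVec, dotProduct, Fin.sum_univ_two]
  linear_combination (a 0 * b 1 - a 1 * b 0) * hg

theorem bracket_units_smul (s : ℤˣ) (a b : Fin 2 → ℂ) :
    bracket (((s : ℤ) : ℂ) • a) (((s : ℤ) : ℂ) • b) = bracket a b := by
  rcases Int.units_eq_one_or s with rfl | rfl <;> simp [bracket_eq]

theorem trace_quandleMap_mul (a b : Fin 2 → ℂ) :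
    (quandleMap a * quandleMap b).1.trace = 2 - bracket a b ^ 2 := by
  rw [Matrix.trace_fin_two]
  simp [coe_quandleMap, bracket_eq, Matrix.SpecialLinearGroup.coe_mul, Matrix.mul_apply,
    Fin.sum_univ_two]
  ring

theorem quandleMap_commute_of_bracket_eq_zero {a b : Fin 2 → ℂ} (h : bracket a b = 0) :
    quandleMap a * quandleMap b = quandleMap b * quandleMap a := by
  rw [bracket_eq] at h
  ext i j
  fin_cases i <;> fin_cases j <;>
    simp [coe_quandleMap, Matrix.SpecialLinearGroup.coe_mul, Matrix.mul_apply, Fin.sum_univ_two]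
  · linear_combination (-a 0 * b 1 - a 1 * b 0) * h
  · linear_combination (2 * a 0 * b 0) * h
  · linear_combination (-2 * a 1 * b 1) * h
  · linear_combination (a 0 * b 1 + a 1 * b 0) * h

/-- Vectors with the same nonzero bracket can be moved into each other by an element of
`SL(2, ℂ)`. -/
theorem exists_mulVec_eq_of_bracket_eq {a b a' b' : Fin 2 → ℂ} (h : bracket a b ≠ 0)
    (h' : bracket a' b' = bracket a b) : ∃ g : SL2C, g.1.mulVec a = a' ∧ g.1.mulVec b = b' := by
  rw [bracket_eq] at h
  rw [bracket_eq, bracket_eq] at h'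
  set d := a 0 * b 1 - a 1 * b 0 with hd
  refine ⟨⟨!![(a' 0 * b 1 - b' 0 * a 1) / d, (b' 0 * a 0 - a' 0 * b 0) / d;
    (a' 1 * b 1 - b' 1 * a 1) / d, (b' 1 * a 0 - a' 1 * b 0) / d], ?_⟩, ?_, ?_⟩
  · rw [Matrix.det_fin_two_of]
    field_simp
    linear_combination d * h' - (a' 0 * b' 1 - a' 1 * b' 0) * hd
  · ext i
    fin_cases i <;> simp [Matrix.mulVec, dotProduct, Fin.sum_univ_two] <;> field_simp
    · linear_combination -a' 0 * hd
    · linear_combination -a' 1 * hd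
  · ext i
    fin_cases i <;> simp [Matrix.mulVec, dotProduct, Fin.sum_univ_two] <;> field_simp
    · linear_combination -b' 0 * hd
    · linear_combination -b' 1 * hd

/-- A matrix is determined by the traces of its products with a basis `1, A, B, A * B` of the
matrix algebra. -/
theorem eq_of_trace_mul_eq {a b : Fin 2 → ℂ} (h : bracket a b ≠ 0) {Y Z : Matrix (Fin 2) (Fin 2) ℂ}
    (h1 : Y.trace = Z.trace) (ha : (Y * (quandleMap a).1).trace = (Z * (quandleMap a).1).trace)
    (hb : (Y * (quandleMap b).1).trace = (Z * (quandleMap b).1).trace)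
    (hab : (Y * ((quandleMap a).1 * (quandleMap b).1)).trace =
      (Z * ((quandleMap a).1 * (quandleMap b).1)).trace) : Y = Z := by
  rw [bracket_eq] at h
  obtain ⟨W, rfl⟩ : ∃ W, Y = Z + W := ⟨Y - Z, by abel⟩
  simp only [add_mul, Matrix.trace_add, add_eq_left] at *
  simp [Matrix.trace_fin_two, coe_quandleMap, Matrix.mul_apply, Fin.sum_univ_two] at h1 ha hb hab
  set d := a 0 * b 1 - a 1 * b 0 with hd
  have cancel : ∀ s t : ℂ, a 0 * t - a 1 * s = 0 → b 0 * t - b 1 * s = 0 → s = 0 ∧ t = 0 :=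
    fun s t hs ht => ⟨(mul_eq_zero.1 (show d * s = 0 by
      linear_combination b 0 * hs - a 0 * ht)).resolve_left h,
      (mul_eq_zero.1 (show d * t = 0 by
      linear_combination b 1 * hs - a 1 * ht)).resolve_left h⟩
  -- As `M(a) - 1` is `v ↦ ⟨a, v⟩ a`, the trace conditions on the difference `W` read `⟨a, Wa⟩ = ⟨b,
  -- Wb⟩ = 0` and `⟨a, b⟩⟨b, Wa⟩ = 0`. Together with `tr W = 0` they force `Wa = Wb = 0`.
  have hba : b 0 * (W 1 0 * a 0 + W 1 1 * a 1) - b 1 * (W 0 0 * a 0 + W 0 1 * a 1) = 0 := by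
    refine (mul_eq_zero.1 (show d * _ = 0 from ?_)).resolve_left h
    linear_combination hab - ha - hb + h1
  obtain ⟨h2, h3⟩ := cancel (W 0 0 * a 0 + W 0 1 * a 1) (W 1 0 * a 0 + W 1 1 * a 1)
    (by linear_combination ha - h1) hba
  obtain ⟨h4, h5⟩ := cancel (W 0 0 * b 0 + W 0 1 * b 1) (W 1 0 * b 0 + W 1 1 * b 1)
    (by linear_combination d * h1 - b 1 * h2 + b 0 * h3) (by linear_combination hb - h1)
  obtain ⟨h6, h7⟩ := cancel (W 0 1) (-W 0 0) (by linear_combination -h2) (by linear_combination -h4)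
  obtain ⟨h8, h9⟩ := cancel (W 1 1) (-W 1 0) (by linear_combination -h3) (by linear_combination -h5)
  rw [neg_eq_zero] at h7 h9
  ext i j
  fin_cases i <;> fin_cases j <;> simp [*]

/-! ### Signs along the knot -/

/-- On a finite cycle, a function with product `1` is a coboundary. -/
theorem Equiv.Perm.exists_apply_eq_mul {α M : Type*} [Fintype α] [CommGroup M]
    (σ : Equiv.Perm α) (hσ : ∀ p q, σ.SameCycle p q) (δ : α → M) (hδ : ∏ p, δ p = 1) :
    ∃ s : α → M, ∀ p, s (σ p) = δ (σ p) * s p := by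
  rcases isEmpty_or_nonempty α with hα | ⟨⟨p₀⟩⟩
  · exact ⟨fun _ => 1, fun p => hα.elim p⟩
  have hc : σ.IsCycleOn ((Finset.univ : Finset α) : Set α) := by
    rw [Finset.coe_univ]
    exact ⟨Set.bijOn_univ.2 σ.bijective, fun p _ q _ => hσ p q⟩
  have hfull : ∀ q, ∏ t ∈ Finset.range (Finset.univ : Finset α).card, δ ((σ ^ t) q) = 1 := by
    intro q
    rw [← hδ]
    refine Finset.prod_bij (fun t _ => (σ ^ t) q) (fun _ _ => Finset.mem_univ _) ?_ ?_
      fun _ _ => rfl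
    · intro t ht u hu h
      exact ((hc.pow_apply_eq_pow_apply (Finset.mem_univ q)).1 h).eq_of_lt_of_lt
        (Finset.mem_range.1 ht) (Finset.mem_range.1 hu)
    · intro r _
      obtain ⟨t, ht, h⟩ := hc.exists_pow_eq (Finset.mem_univ q) (Finset.mem_univ r)
      exact ⟨t, Finset.mem_range.2 ht, h⟩
  -- The partial product along the orbit, starting after `p₀`. A full turn contributes `1`, so `F k`
  -- depends only on the point `(σ ^ k) p₀`.
  let F : ℕ → M := fun k => ∏ t ∈ Finset.range k, δ ((σ ^ (t + 1)) p₀)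
  have hF : Function.Periodic F (Finset.univ : Finset α).card := by
    intro k
    have h := hfull ((σ ^ (k + 1)) p₀)
    simp only [← Equiv.Perm.mul_apply, ← pow_add] at h
    simp only [F, Finset.prod_range_add]
    rw [mul_eq_left, ← h]
    exact Finset.prod_congr rfl fun t _ => by rw [show k + t + 1 = t + (k + 1) by ring]
  have hF' : ∀ k l, (σ ^ k) p₀ = (σ ^ l) p₀ → F k = F l := fun k l h => by
    rw [← hF.map_mod_nat k, ← hF.map_mod_nat l,
      (hc.pow_apply_eq_pow_apply (Finset.mem_univ p₀)).1 h]
  choose k _ hk using fun p => hc.exists_pow_eq (Finset.mem_univ p₀) (Finset.mem_univ p)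
  refine ⟨fun p => F (k p), fun p => ?_⟩
  have h : (σ ^ (k p + 1)) p₀ = σ p := by rw [pow_succ', Equiv.Perm.mul_apply, hk]
  change F (k (σ p)) = δ (σ p) * F (k p)
  rw [hF' (k (σ p)) (k p + 1) (by rw [hk, h])]
  simp only [F, Finset.prod_range_succ, h, mul_comm]

namespace KnotDiagram

variable (D : KnotDiagram)

instance : Finite D.Arc := Quot.finite _

theorem mk_next_symm (c : Fin D.n) :
    (Quot.mk _ (D.next.symm (c, true)) : D.Arc) = D.overArc c :=
  Quot.sound ⟨c, rfl, rfl⟩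

/-- A property that propagates through the crossings along the orientation propagates from each
arc to all others. -/
theorem arc_propagate {P : D.Arc → Prop} (h : ∀ c, P (D.inArc c) → P (D.outArc c)) {i : D.Arc}
    (hi : P i) (j : D.Arc) : P j := by
  have step : ∀ p, P (Quot.mk _ p) → P (Quot.mk _ (D.next p)) := by
    intro p hp
    obtain ⟨⟨c, o⟩, rfl⟩ := D.next.symm.surjective p
    rw [Equiv.apply_symm_apply]
    cases o
    · exact h c hp
    · rwa [mk_next_symm] at hp
  induction i using Quot.ind with | _ p
  induction j using Quot.ind with | _ q
  obtain ⟨k, -, rfl⟩ := (D.one_component p q).exists_pow_eq'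
  clear * - hi step
  induction k with
  | zero => exact hi
  | succ k ih =>
    rw [pow_succ', Equiv.Perm.mul_apply]
    exact step _ ih

/-- Multiply over all edges, indexed once by their start and once by their end. An over-passage is
entered and left on the same arc, so the over-arc factors cancel. -/
theorem prod_outArc_eq_prod_inArc {M : Type*} [CommGroup M] (s : D.Arc → M) :
    ∏ c, s (D.outArc c) = ∏ c, s (D.inArc c) := by
  have h : ∏ p : Fin D.n × Bool, s (Quot.mk _ p) =
      ∏ p : Fin D.n × Bool, s (Quot.mk _ (D.next.symm p)) :=
    (Equiv.prod_comp D.next.symm fun p => s (Quot.mk _ p)).symm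
  simp only [Fintype.prod_prod_type, Fintype.prod_bool, Finset.prod_mul_distrib,
    mk_next_symm] at h
  exact mul_left_cancel h

/-- The signs at the crossings can be changed arbitrarily, up to the total sign, by changing the
signs of the arcs. -/
theorem exists_arc_signs {M : Type*} [CommGroup M] (δ : Fin D.n → M) (hδ : ∏ c, δ c = 1) :
    ∃ s : D.Arc → M, ∀ c, s (D.outArc c) = δ c * s (D.inArc c) := by
  -- The weight `1` at over-passages lets the function on edges descend to arcs.
  obtain ⟨s, hs⟩ := D.next.exists_apply_eq_mul D.one_component
    (fun p => if p.2 = true then 1 else δ p.1)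
    (by simpa [Fintype.prod_prod_type] using hδ)
  have hs' : ∀ p, s p = (if p.2 = true then 1 else δ p.1) * s (D.next.symm p) := fun p => by
    simpa using hs (D.next.symm p)
  refine ⟨Quot.lift s ?_, fun c => (hs' (c, false)).trans (by simp; rfl)⟩
  rintro _ _ ⟨c, rfl, rfl⟩
  simpa using (hs' (c, true)).symm

end KnotDiagram

theorem if_qr_ql_eq (s : ℤˣ) (a b : Fin 2 → ℂ) :
    (if s = 1 then qr a b else ql a b) = (quandleMap b ^ (-(s : ℤ))).1.mulVec a := by
  rcases Int.units_eq_one_or s with rfl | rfl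
  · simp [qr]
  · have h : (-1 : ℤˣ) ≠ 1 := by decide
    simp [ql, h]

theorem Int.units_smul_smul (s t : ℤˣ) (a : Fin 2 → ℂ) :
    ((s : ℤ) : ℂ) • ((t : ℤ) : ℂ) • a = (((s * t : ℤˣ) : ℤ) : ℂ) • a := by
  rw [smul_smul]; push_cast; rfl

theorem Int.units_smul_injective {s t : ℤˣ} {a : Fin 2 → ℂ} (ha : a ≠ 0)
    (h : ((s : ℤ) : ℂ) • a = ((t : ℤ) : ℂ) • a) : s = t := by
  have := smul_left_injective ℂ ha h
  exact Units.ext (by exact_mod_cast this)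

theorem exists_units_smul_of_quandleMap_eq {a b : Fin 2 → ℂ} (h : quandleMap a = quandleMap b) :
    ∃ s : ℤˣ, b = ((s : ℤ) : ℂ) • a := by
  rcases quandleMap_eq_iff.1 h with rfl | rfl
  · exact ⟨1, by simp⟩
  · exact ⟨-1, by simp⟩

/-! ### Colorings of a representation and their sign-types -/

namespace KnotDiagram

variable {D : KnotDiagram}

/-- The coloring `a` is associated to the representation `ρ`. -/
def Colors (a : D.Arc → Fin 2 → ℂ) (ρ : D.Rpar) : Prop :=
  ∀ i, ρ.1 (D.meridian i) = quandleMap (a i)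

theorem meridian_outArc (c : Fin D.n) : D.meridian (D.outArc c) =
    D.meridian (D.overArc c) ^ (-(D.sign c : ℤ)) * D.meridian (D.inArc c) *
      D.meridian (D.overArc c) ^ (D.sign c : ℤ) := by
  have h : (PresentedGroup.mk (Set.range D.relator)) (D.relator c) = 1 :=
    PresentedGroup.one_of_mem ⟨c, rfl⟩
  rw [relator, mul_assoc, mul_assoc, map_mul, map_inv, inv_mul_eq_one] at h
  simp only [map_mul, map_zpow] at h
  rw [mul_assoc]
  exact h

/-- The group element through which the crossing `c` acts on its incoming under-arc. -/
noncomputable def crossingElement (a : D.Arc → Fin 2 → ℂ) (c : Fin D.n) : SL2C :=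
  quandleMap (a (D.overArc c)) ^ (-(D.sign c : ℤ))

theorem Colors.quandleMap_outArc {a : D.Arc → Fin 2 → ℂ} {ρ : D.Rpar} (h : Colors a ρ)
    (c : Fin D.n) : quandleMap (a (D.outArc c)) =
      quandleMap ((crossingElement a c).1.mulVec (a (D.inArc c))) := by
  rw [quandleMap_mulVec, ← h, meridian_outArc, map_mul, map_mul, map_zpow, map_zpow, h, h,
    crossingElement, ← zpow_neg, neg_neg]

theorem mem_signedQuandleSystem_iff {ε : Fin D.n → ℤˣ} {a : D.Arc → Fin 2 → ℂ} :
    a ∈ D.signedQuandleSystem ε ↔ a ∈ D.quandleSystem ∧ ∀ c,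
      (((ε c : ℤˣ) : ℤ) : ℂ) • a (D.outArc c) =
        (crossingElement a c).1.mulVec (a (D.inArc c)) := by
  simp only [signedQuandleSystem, Set.mem_ofPred_eq, if_qr_ql_eq, crossingElement]

theorem Colors.mem_quandleSystem {a : D.Arc → Fin 2 → ℂ} {ρ : D.Rpar} (h : Colors a ρ) :
    a ∈ D.quandleSystem := ⟨_, ρ, rfl, h⟩

/-- A zero color means a trivial meridian; all meridians are conjugate, so the whole representation
would be trivial. Nonvanishing lets signs be read off from vectors. -/
theorem Colors.ne_zero {a : D.Arc → Fin 2 → ℂ} {ρ : D.Rpar} (h : Colors a ρ) (i : D.Arc) :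
    a i ≠ 0 := by
  intro hi
  have hall : ∀ j, ρ.1 (D.meridian j) = 1 := by
    intro j
    refine D.arc_propagate (P := fun j => ρ.1 (D.meridian j) = 1) (i := i) (fun c hc => ?_) ?_ j
    · simp [meridian_outArc, hc]
    · rw [h, hi, quandleMap_zero]
  obtain ⟨k, l, hkl⟩ := ρ.2.2
  exact hkl (by rw [hall, hall])

/-- Otherwise all meridian images commute, and the Wirtinger relations make them equal. -/
theorem Colors.exists_bracket_ne_zero {a : D.Arc → Fin 2 → ℂ} {ρ : D.Rpar} (h : Colors a ρ) :
    ∃ k l, bracket (a k) (a l) ≠ 0 := by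
  by_contra! hz
  obtain ⟨k, l, hkl⟩ := ρ.2.2
  refine hkl (D.arc_propagate (P := fun j => ρ.1 (D.meridian k) = ρ.1 (D.meridian j))
    (fun c hc => ?_) rfl l)
  have hcomm : Commute (ρ.1 (D.meridian (D.inArc c))) (ρ.1 (D.meridian (D.overArc c))) := by
    rw [h, h]
    exact quandleMap_commute_of_bracket_eq_zero (hz _ _)
  rw [hc, meridian_outArc, map_mul, map_mul, map_zpow, map_zpow, mul_assoc,
    (hcomm.zpow_right _).eq, ← mul_assoc, ← zpow_add, neg_add_cancel, zpow_zero, one_mul]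

/-- Colorings with the same associated representation differ by signs of the arcs. -/
theorem Colors.exists_signs {a b : D.Arc → Fin 2 → ℂ} {ρ : D.Rpar} (ha : Colors a ρ)
    (hb : Colors b ρ) : ∃ s : D.Arc → ℤˣ, ∀ i, b i = ((s i : ℤ) : ℂ) • a i := by
  choose s hs using fun i => exists_units_smul_of_quandleMap_eq ((ha i).symm.trans (hb i))
  exact ⟨s, hs⟩

theorem crossingElement_smul (s : D.Arc → ℤˣ) (a : D.Arc → Fin 2 → ℂ) (c : Fin D.n) :
    crossingElement (fun i => ((s i : ℤ) : ℂ) • a i) c = crossingElement a c := by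
  simp only [crossingElement, quandleMap_units_smul]

theorem exists_colors (ρ : D.Rpar) : ∃ a, Colors a ρ := by
  choose a ha using fun i => exists_quandleMap_eq _ (ρ.2.1 i)
  exact ⟨a, fun i => (ha i).symm⟩

theorem exists_colors_mem_coloringsOfType (ε : D.SignTypePair) (ρ : D.Rpar) :
    ∃ a ∈ D.coloringsOfType ε, Colors a ρ := by
  obtain ⟨a, ha⟩ := exists_colors ρ
  -- `η` is the sign-type of the arbitrary coloring `a`; any sign-type with the same total sign can
  -- be reached from it.
  choose η hη using fun c => exists_units_smul_of_quandleMap_eq (ha.quandleMap_outArc c)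
  have change : ∀ e : Fin D.n → ℤˣ, ∏ c, e c = ∏ c, η c →
      ∃ b ∈ D.signedQuandleSystem e, Colors b ρ := by
    intro e he
    obtain ⟨s, hs⟩ := D.exists_arc_signs (fun c => e c * η c)
      (by rw [Finset.prod_mul_distrib, he, Int.units_mul_self])
    have hb : Colors (fun i => ((s i : ℤ) : ℂ) • a i) ρ := fun i => by
      rw [quandleMap_units_smul, ha]
    refine ⟨_, mem_signedQuandleSystem_iff.2 ⟨hb.mem_quandleSystem, fun c => ?_⟩, hb⟩
    rw [crossingElement_smul, Matrix.mulVec_smul, hη, Int.units_smul_smul, Int.units_smul_smul, hs,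
      ← mul_assoc, ← mul_assoc, Int.units_mul_self, one_mul, mul_comm]
  rcases Int.units_eq_one_or (∏ c, η c) with h | h
  · obtain ⟨b, hb, hb'⟩ := change ε.pos (ε.prod_pos.trans h.symm)
    exact ⟨b, Or.inl hb, hb'⟩
  · obtain ⟨b, hb, hb'⟩ := change ε.neg (ε.prod_neg.trans h.symm)
    exact ⟨b, Or.inr hb, hb'⟩

/-- Two colorings of a representation whose sign-types agree as soon as their total signs agree
are equal up to one common sign. -/
theorem Colors.exists_sign_of_mem {e e' : Fin D.n → ℤˣ} (hee : ∏ c, e c = ∏ c, e' c → e = e')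
    {a b : D.Arc → Fin 2 → ℂ} {ρ : D.Rpar} (ha : Colors a ρ) (hb : Colors b ρ)
    (hae : a ∈ D.signedQuandleSystem e) (hbe : b ∈ D.signedQuandleSystem e') (i : D.Arc) :
    ∃ s : ℤˣ, ∀ j, b j = ((s : ℤ) : ℂ) • a j := by
  obtain ⟨s, hs⟩ := ha.exists_signs hb
  obtain rfl : b = fun i => ((s i : ℤ) : ℂ) • a i := funext hs
  rw [mem_signedQuandleSystem_iff] at hae hbe
  have key : ∀ c, e' c * s (D.outArc c) = s (D.inArc c) * e c := fun c => by
    refine Int.units_smul_injective (ha.ne_zero (D.outArc c)) ?_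
    have h := hbe.2 c
    rwa [crossingElement_smul, Matrix.mulVec_smul, ← hae.2 c, Int.units_smul_smul,
      Int.units_smul_smul] at h
  -- The arc signs cancel in the product of `key` over all crossings: the total sign depends on `ρ`
  -- alone.
  have hprod : ∏ c, e c = ∏ c, e' c := by
    have h := Finset.prod_congr (rfl : Finset.univ = Finset.univ) fun c _ => key c
    rw [Finset.prod_mul_distrib, Finset.prod_mul_distrib, D.prod_outArc_eq_prod_inArc,
      mul_comm] at h
    exact (mul_left_cancel h).symm
  obtain rfl := hee hprod
  refine ⟨s i, fun j => ?_⟩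
  rw [hs, D.arc_propagate (P := fun j => s j = s i) (fun c hc => ?_) rfl j]
  have h := key c
  rw [mul_comm] at h
  rw [mul_right_cancel h, hc]

theorem Colors.bracket_eq_of_mem_coloringsOfType {ε : D.SignTypePair}
    {a b : D.Arc → Fin 2 → ℂ} {ρ : D.Rpar} (ha : Colors a ρ) (hb : Colors b ρ)
    (hae : a ∈ D.coloringsOfType ε) (hbe : b ∈ D.coloringsOfType ε) (i j : D.Arc) :
    bracket (b i) (b j) = bracket (a i) (a j) := by
  have hne : (1 : ℤˣ) ≠ -1 := by decide
  suffices ∃ s : ℤˣ, ∀ j, b j = ((s : ℤ) : ℂ) • a j by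
    obtain ⟨s, hs⟩ := this
    rw [hs, hs, bracket_units_smul]
  rcases hae with hae | hae <;> rcases hbe with hbe | hbe
  · exact ha.exists_sign_of_mem (fun _ => rfl) hb hae hbe i
  · exact ha.exists_sign_of_mem (fun h => by simp [ε.prod_pos, ε.prod_neg, hne] at h) hb hae hbe i
  · exact ha.exists_sign_of_mem (fun h => by simp [ε.prod_pos, ε.prod_neg, hne.symm] at h) hb hae
      hbe i
  · exact ha.exists_sign_of_mem (fun _ => rfl) hb hae hbe i

/-! ### Characters and conjugacy -/

/-- Parabolic representations with the same character are conjugate. -/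
theorem exists_conj_of_charSetoid {ρ ρ' : D.Rpar} (h : ρ ≈ ρ') :
    ∃ g : SL2C, ∀ w, ρ'.1 w = g * ρ.1 w * g⁻¹ := by
  obtain ⟨a, ha⟩ := exists_colors ρ
  obtain ⟨b, hb⟩ := exists_colors ρ'
  obtain ⟨k, l, hkl⟩ := ha.exists_bracket_ne_zero
  have hsq : bracket (b k) (b l) ^ 2 = bracket (a k) (a l) ^ 2 := by
    have h' := h (D.meridian k * D.meridian l)
    rw [map_mul, map_mul, ha, ha, hb, hb, trace_quandleMap_mul, trace_quandleMap_mul] at h'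
    linear_combination h'
  -- Traces see the bracket only up to sign; negating `b l` repairs the sign without changing its
  -- matrix.
  obtain ⟨v, hv, hkv⟩ : ∃ v, quandleMap v = quandleMap (b l) ∧
      bracket (b k) v = bracket (a k) (a l) := by
    rcases sq_eq_sq_iff_eq_or_eq_neg.1 hsq with h' | h'
    · exact ⟨b l, rfl, h'⟩
    · refine ⟨-b l, (quandleMap_eq_iff.2 (Or.inr rfl)).symm, ?_⟩
      rw [← neg_eq_iff_eq_neg] at h'
      rw [← h']
      simp [bracket_eq]
      ring
  obtain ⟨g, hgk, hgl⟩ := exists_mulVec_eq_of_bracket_eq hkl hkv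
  have hk : ρ'.1 (D.meridian k) = g * ρ.1 (D.meridian k) * g⁻¹ := by
    rw [ha, hb, ← hgk, quandleMap_mulVec]
  have hl : ρ'.1 (D.meridian l) = g * ρ.1 (D.meridian l) * g⁻¹ := by
    rw [ha, hb, ← hv, ← hgl, quandleMap_mulVec]
  have htr : ∀ w, (ρ'.1 w).1.trace = (g * ρ.1 w * g⁻¹).1.trace := by
    intro w
    rw [Matrix.SpecialLinearGroup.coe_mul, Matrix.trace_mul_comm,
      ← Matrix.SpecialLinearGroup.coe_mul, inv_mul_cancel_left]
    exact (h w).symm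
  have hmul : ∀ w z, ρ'.1 z = g * ρ.1 z * g⁻¹ →
      ((ρ'.1 w).1 * (ρ'.1 z).1).trace = ((g * ρ.1 w * g⁻¹).1 * (ρ'.1 z).1).trace := by
    intro w z hz
    have h' := htr (w * z)
    rw [map_mul, map_mul, show g * (ρ.1 w * ρ.1 z) * g⁻¹ = g * ρ.1 w * g⁻¹ * (g * ρ.1 z * g⁻¹) by
      group, ← hz] at h'
    simpa only [Matrix.SpecialLinearGroup.coe_mul] using h'
  refine ⟨g, fun w => Subtype.ext (eq_of_trace_mul_eq (a := b k) (b := v) (by rwa [hkv])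
    (htr w) ?_ ?_ ?_)⟩
  · rw [← hb]
    exact hmul w _ hk
  · rw [hv, ← hb]
    exact hmul w _ hl
  · have h' := hmul w (D.meridian k * D.meridian l) (by rw [map_mul, map_mul, hk, hl]; group)
    rwa [map_mul, Matrix.SpecialLinearGroup.coe_mul, hb, hb, ← hv] at h'

theorem Colors.conj {a : D.Arc → Fin 2 → ℂ} {ρ ρ' : D.Rpar} (h : Colors a ρ) {g : SL2C}
    (hg : ∀ w, ρ'.1 w = g * ρ.1 w * g⁻¹) : Colors (fun i => g.1.mulVec (a i)) ρ' := fun i => by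
  rw [hg, h, quandleMap_mulVec]

theorem Colors.conj_mem_signedQuandleSystem {a : D.Arc → Fin 2 → ℂ} {ρ ρ' : D.Rpar}
    (h : Colors a ρ) {g : SL2C} (hg : ∀ w, ρ'.1 w = g * ρ.1 w * g⁻¹) {e : Fin D.n → ℤˣ}
    (hae : a ∈ D.signedQuandleSystem e) :
    (fun i => g.1.mulVec (a i)) ∈ D.signedQuandleSystem e := by
  rw [mem_signedQuandleSystem_iff] at hae ⊢
  refine ⟨(h.conj hg).mem_quandleSystem, fun c => ?_⟩
  have hc : crossingElement (fun i => g.1.mulVec (a i)) c = g * crossingElement a c * g⁻¹ := by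
    rw [crossingElement, crossingElement, quandleMap_mulVec, conj_zpow]
  rw [hc, Matrix.mulVec_mulVec, ← Matrix.SpecialLinearGroup.coe_mul, inv_mul_cancel_right,
    Matrix.SpecialLinearGroup.coe_mul, ← Matrix.mulVec_mulVec, ← hae.2 c, Matrix.mulVec_smul]

/-- The brackets of colorings of sign-type `ε` depend only on the point of `X_par`. -/
theorem Represents.bracket_eq {ε : D.SignTypePair} {χ : D.Xpar} {a b : D.Arc → Fin 2 → ℂ}
    (ha : D.Represents a χ) (hb : D.Represents b χ) (hae : a ∈ D.coloringsOfType ε)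
    (hbe : b ∈ D.coloringsOfType ε) (i j : D.Arc) :
    bracket (b i) (b j) = bracket (a i) (a j) := by
  obtain ⟨ρ, hρ, ha⟩ := ha
  obtain ⟨ρ', hρ', hb⟩ := hb
  obtain ⟨g, hg⟩ := exists_conj_of_charSetoid (Quotient.exact (hρ.trans hρ'.symm))
  have hga : (fun i => g.1.mulVec (a i)) ∈ D.coloringsOfType ε :=
    hae.imp (Colors.conj_mem_signedQuandleSystem ha hg)
      (Colors.conj_mem_signedQuandleSystem ha hg)
  rw [Colors.bracket_eq_of_mem_coloringsOfType (Colors.conj ha hg) hb hga hbe, bracket_mulVec]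

theorem exists_mem_coloringsOfType_represents (ε : D.SignTypePair) (χ : D.Xpar) :
    ∃ a ∈ D.coloringsOfType ε, D.Represents a χ := by
  obtain ⟨a, ha, ha'⟩ := exists_colors_mem_coloringsOfType ε χ.out
  exact ⟨a, ha, χ.out, Quotient.out_eq χ, ha'⟩

theorem uValue_eq {ε : D.SignTypePair} {χ : D.Xpar} {a : D.Arc → Fin 2 → ℂ}
    (hae : a ∈ D.coloringsOfType ε) (ha : D.Represents a χ) (i j : D.Arc) :
    D.uValue ε i j χ = bracket (a i) (a j) := by
  have h := exists_mem_coloringsOfType_represents ε χ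
  rw [uValue, dif_pos h]
  exact ha.bracket_eq h.choose_spec.2 hae h.choose_spec.1 i j

/-! ### Automorphisms of `ℂ` acting on `X_par` -/

/-- The action of the automorphisms of `ℂ` on the representations. -/
def Rpar.map (σ : ℂ ≃+* ℂ) (ρ : D.Rpar) : D.Rpar :=
  ⟨(Matrix.SpecialLinearGroup.map (σ : ℂ →+* ℂ)).comp ρ.1, by
    obtain ⟨ρ, h, k, l, hkl⟩ := ρ
    refine ⟨fun i => ?_, k, l, fun h => hkl ?_⟩
    · have := congrArg σ (h i)
      rw [Matrix.trace_fin_two, map_add, map_ofNat] at this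
      rw [Matrix.trace_fin_two]
      simpa using this
    · ext r s
      have := congrArg (fun A : SL2C => A.1 r s) h
      simpa using this⟩

theorem Rpar.map_apply (σ : ℂ ≃+* ℂ) (ρ : D.Rpar) (w : D.KnotGroup) (r s : Fin 2) :
    ((ρ.map σ).1 w).1 r s = σ ((ρ.1 w).1 r s) := rfl

theorem Rpar.trace_map (σ : ℂ ≃+* ℂ) (ρ : D.Rpar) (w : D.KnotGroup) :
    ((ρ.map σ).1 w).1.trace = σ (ρ.1 w).1.trace := by
  simp only [Matrix.trace_fin_two, Rpar.map_apply, map_add]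

/-- The action of the automorphisms of `ℂ` on `X_par`. -/
def Xpar.map (σ : ℂ ≃+* ℂ) : D.Xpar → D.Xpar :=
  Quotient.map (Rpar.map σ) fun ρ ρ' h g => by rw [Rpar.trace_map, Rpar.trace_map, h g]

theorem Xpar.map_map {σ τ : ℂ ≃+* ℂ} (h : ∀ z, τ (σ z) = z) (χ : D.Xpar) :
    Xpar.map τ (Xpar.map σ χ) = χ := by
  induction χ using Quotient.ind with | _ ρ
  exact Quotient.sound fun g => by rw [Rpar.trace_map, Rpar.trace_map, h]

theorem Xpar.map_bijective (σ : ℂ ≃+* ℂ) : Function.Bijective (Xpar.map σ : D.Xpar → D.Xpar) :=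
  Function.bijective_iff_has_inverse.2 ⟨Xpar.map σ.symm,
    Xpar.map_map σ.symm_apply_apply, Xpar.map_map σ.apply_symm_apply⟩

theorem Represents.map (σ : ℂ ≃+* ℂ) {χ : D.Xpar} {a : D.Arc → Fin 2 → ℂ}
    (h : D.Represents a χ) : D.Represents (fun i => σ ∘ a i) (Xpar.map σ χ) := by
  obtain ⟨ρ, rfl, ha⟩ := h
  refine ⟨ρ.map σ, rfl, fun i => ?_⟩
  ext r s
  rw [Rpar.map_apply, ha]
  fin_cases r <;> fin_cases s <;> simp [coe_quandleMap]

theorem Represents.map_mem_signedQuandleSystem (σ : ℂ ≃+* ℂ) {χ : D.Xpar}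
    {a : D.Arc → Fin 2 → ℂ} (h : D.Represents a χ) {e : Fin D.n → ℤˣ}
    (hae : a ∈ D.signedQuandleSystem e) :
    (fun i => σ ∘ a i) ∈ D.signedQuandleSystem e := by
  refine ⟨⟨_, h.map σ⟩, fun c => ?_⟩
  have hc := hae.2 c
  have hr : ∀ u v : Fin 2 → ℂ, qr (σ ∘ u) (σ ∘ v) = σ ∘ qr u v := fun u v => by
    ext r
    fin_cases r <;> simp [qr, coe_quandleMap, Matrix.vecHead, Matrix.vecTail,
      Matrix.SpecialLinearGroup.coe_inv, Matrix.adjugate_fin_two]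
  have hl : ∀ u v : Fin 2 → ℂ, ql (σ ∘ u) (σ ∘ v) = σ ∘ ql u v := fun u v => by
    ext r
    fin_cases r <;> simp [ql, coe_quandleMap, Matrix.vecHead, Matrix.vecTail]
  rw [hr, hl, ← apply_ite (σ ∘ ·), ← hc]
  ext r
  simp

/-- Applying `σ` entrywise to a coloring keeps its sign-type, because `σ` fixes `±1`. -/
theorem uValue_map (σ : ℂ ≃+* ℂ) (ε : D.SignTypePair) (i j : D.Arc) (χ : D.Xpar) :
    D.uValue ε i j (Xpar.map σ χ) = σ (D.uValue ε i j χ) := by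
  obtain ⟨a, hae, ha⟩ := exists_mem_coloringsOfType_represents ε χ
  rw [uValue_eq hae ha, uValue_eq (hae.imp (ha.map_mem_signedQuandleSystem σ)
    (ha.map_mem_signedQuandleSystem σ)) (ha.map σ)]
  simp [_root_.bracket_eq]

theorem map_uPolynomial [Finite D.Xpar] (σ : ℂ ≃+* ℂ) (ε : D.SignTypePair) (i j : D.Arc) :
    (D.uPolynomial ε i j).map (σ : ℂ →+* ℂ) = D.uPolynomial ε i j := by
  have := Fintype.ofFinite D.Xpar
  rw [uPolynomial, finprod_eq_prod_of_fintype, Polynomial.map_prod]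
  refine Eq.trans ?_ ((Xpar.map_bijective σ).prod_comp
    fun χ => Polynomial.X - Polynomial.C (D.uValue ε i j χ))
  refine Finset.prod_congr rfl fun χ _ => ?_
  simp [uValue_map]

end KnotDiagram

/-! ### Finite generation of the coordinate ring and finiteness of `X_par` -/

/-- For a singular two by two matrix `N`, the matrix `N * A * N` is a multiple of `N`. -/
theorem Matrix.mul_mul_self_of_det_eq_zero {R : Type*} [CommRing R]
    {N : Matrix (Fin 2) (Fin 2) R} (hN : N.det = 0) (A : Matrix (Fin 2) (Fin 2) R) :
    N * A * N = (N * A).trace • N := by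
  rw [Matrix.det_fin_two] at hN
  ext i j
  fin_cases i <;> fin_cases j <;>
    simp [Matrix.mul_apply, Matrix.trace_fin_two, Fin.sum_univ_two]
  · linear_combination (-A 1 1) * hN
  · linear_combination A 0 1 * hN
  · linear_combination A 1 0 * hN
  · linear_combination (-A 0 0) * hN

/-- The pointwise trace of a family of matrices. -/
def traceFamily (X : Type*) : (X → Matrix (Fin 2) (Fin 2) ℂ) →ₗ[ℂ] X → ℂ :=
  (Matrix.traceLinearMap (Fin 2) ℂ ℂ).compLeft X

@[simp]
theorem traceFamily_apply {X : Type*} (Y : X → Matrix (Fin 2) (Fin 2) ℂ) (x : X) :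
    traceFamily X Y x = (Y x).trace := rfl

/-- The traces of all products of singular two by two matrices are polynomials in the traces of
the products without repetition. -/
theorem traceFamily_mem_adjoin {X ι : Type*} (N : ι → X → Matrix (Fin 2) (Fin 2) ℂ)
    (hN : ∀ i x, (N i x).det = 0) {Y : X → Matrix (Fin 2) (Fin 2) ℂ}
    (hY : Y ∈ Algebra.adjoin ℂ (Set.range N)) :
    traceFamily X Y ∈ Algebra.adjoin ℂ
      ((fun l : List ι => traceFamily X (l.map N).prod) '' {l | l.Nodup}) := by
  set S := Algebra.adjoin ℂ
    ((fun l : List ι => traceFamily X (l.map N).prod) '' {l | l.Nodup}) with hS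
  have words : ∀ (n : ℕ) (l : List ι), l.length = n → traceFamily X (l.map N).prod ∈ S := by
    intro n
    induction n using Nat.strong_induction_on with
    | _ n ih =>
      rintro l rfl
      by_cases hl : l.Nodup
      · exact Algebra.subset_adjoin ⟨l, hl, rfl⟩
      · obtain ⟨i, hi⟩ := List.exists_duplicate_iff_not_nodup.2 hl
        obtain ⟨r, t, s, rfl⟩ : ∃ r t s, l = r ++ i :: (t ++ i :: s) := by
          rw [List.duplicate_iff_sublist] at hi
          obtain ⟨u, w, rfl, hu, hw⟩ := List.cons_sublist_iff.1 hi
          obtain ⟨r, t, rfl⟩ := List.append_of_mem hu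
          obtain ⟨t', s, rfl⟩ := List.append_of_mem (List.singleton_sublist.1 hw)
          exact ⟨r, t ++ t', s, by simp⟩
        -- Rotate the word under the trace to `N i * T * N i * S * R` and use `N i * T * N i = tr(N
        -- i * T) • N i`; both resulting words are shorter.
        have h : traceFamily X ((r ++ i :: (t ++ i :: s)).map N).prod =
            traceFamily X ((i :: t).map N).prod * traceFamily X ((i :: (s ++ r)).map N).prod := by
          funext x
          have key := Matrix.mul_mul_self_of_det_eq_zero (hN i x) ((t.map N).prod x)
          simp only [List.map_append, List.map_cons, List.prod_append, List.prod_cons,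
            traceFamily_apply, Pi.mul_apply]
          rw [Matrix.trace_mul_comm]
          simp only [← mul_assoc]
          rw [key]
          simp only [Matrix.smul_mul, Matrix.trace_smul, smul_eq_mul]
        rw [h]
        refine S.mul_mem (ih _ ?_ _ rfl) (ih _ ?_ _ rfl) <;> simp <;> omega
  rw [← Subalgebra.mem_toSubmodule, Algebra.adjoin_eq_span] at hY
  induction hY using Submodule.span_induction with
  | mem Y hY =>
    obtain ⟨l, hl, rfl⟩ := Submonoid.exists_list_of_mem_closure hY
    obtain ⟨l, rfl⟩ : ∃ l' : List ι, l = l'.map N := by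
      clear hY
      induction l with
      | nil => exact ⟨[], rfl⟩
      | cons Z l ih =>
        obtain ⟨i, rfl⟩ := hl Z (by simp)
        obtain ⟨l', rfl⟩ := ih fun y hy => hl y (by simp [hy])
        exact ⟨i :: l', rfl⟩
    exact words _ l rfl
  | zero => rw [map_zero]; exact S.zero_mem
  | add Y Z _ _ hY hZ => rw [map_add]; exact S.add_mem hY hZ
  | smul c Y _ hY => rw [map_smul]; exact S.smul_mem hY c

namespace KnotDiagram

variable (D : KnotDiagram)

/-- The matrix of a group element as a function on `X_par`, for some choice of representatives. -/
noncomputable def matrixFun : D.KnotGroup →* (D.Xpar → Matrix (Fin 2) (Fin 2) ℂ) where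
  toFun g χ := (χ.out.1 g).1
  map_one' := by funext χ; simp
  map_mul' g h := by funext χ; simp [Matrix.SpecialLinearGroup.coe_mul]

theorem traceFamily_matrixFun (g : D.KnotGroup) :
    traceFamily D.Xpar (D.matrixFun g) = D.traceFun g := by
  funext χ
  conv_rhs => rw [← Quotient.out_eq χ]
  rfl

theorem matrixFun_mem_adjoin (g : D.KnotGroup) :
    D.matrixFun g ∈ Algebra.adjoin ℂ (Set.range fun i => D.matrixFun (D.meridian i) - 1) := by
  set S := Algebra.adjoin ℂ (Set.range fun i => D.matrixFun (D.meridian i) - 1) with hS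
  suffices D.matrixFun g ∈ S ∧ D.matrixFun g⁻¹ ∈ S from this.1
  have hg : g ∈ Subgroup.closure (Set.range D.meridian) := by
    have h := PresentedGroup.closure_range_of (Set.range D.relator)
    change g ∈ Subgroup.closure (Set.range (PresentedGroup.of : D.Arc → D.KnotGroup))
    rw [h]
    trivial
  induction hg using Subgroup.closure_induction with
  | mem g hg =>
    obtain ⟨i, rfl⟩ := hg
    have hN : D.matrixFun (D.meridian i) - 1 ∈ S := Algebra.subset_adjoin ⟨i, rfl⟩
    refine ⟨by simpa only [sub_add_cancel] using S.add_mem hN S.one_mem, ?_⟩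
    -- Trace 2 gives `A⁻¹ = 2 - A`, so inverses need no new generators.
    have h : D.matrixFun (D.meridian i)⁻¹ = 1 - (D.matrixFun (D.meridian i) - 1) := by
      funext χ
      have ht := χ.out.2.1 i
      rw [Matrix.trace_fin_two] at ht
      change (χ.out.1 (D.meridian i)⁻¹).1 = 1 - ((χ.out.1 (D.meridian i)).1 - 1)
      rw [map_inv, Matrix.SpecialLinearGroup.coe_inv, Matrix.adjugate_fin_two]
      ext k l
      fin_cases k <;> fin_cases l <;> simp
      · linear_combination ht
      · linear_combination ht
    rw [h]
    exact S.sub_mem S.one_mem hN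
  | one => rw [inv_one, map_one]; exact ⟨S.one_mem, S.one_mem⟩
  | mul g h _ _ hg hh =>
    rw [mul_inv_rev, map_mul, map_mul]
    exact ⟨S.mul_mem hg.1 hh.1, S.mul_mem hh.2 hg.2⟩
  | inv g _ hg => exact ⟨hg.2, by rw [inv_inv]; exact hg.1⟩

theorem traceFamily_mem_coordinateRing (l : List D.Arc) :
    traceFamily D.Xpar (l.map fun i => D.matrixFun (D.meridian i) - 1).prod ∈
      D.coordinateRing := by
  have hspan : (l.map fun i => D.matrixFun (D.meridian i) - 1).prod ∈
      Algebra.adjoin ℂ (MonoidHom.mrange D.matrixFun : Set (D.Xpar → Matrix (Fin 2) (Fin 2) ℂ)) := by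
    refine Subalgebra.list_prod_mem _ fun Y hY => ?_
    obtain ⟨i, -, rfl⟩ := List.mem_map.1 hY
    exact Subalgebra.sub_mem _ (Algebra.subset_adjoin ⟨_, rfl⟩) (Subalgebra.one_mem _)
  rw [← Subalgebra.mem_toSubmodule, Algebra.adjoin_eq_span, Submonoid.closure_eq] at hspan
  generalize (l.map fun i => D.matrixFun (D.meridian i) - 1).prod = Y at hspan
  induction hspan using Submodule.span_induction with
  | mem Y hY =>
    obtain ⟨g, rfl⟩ := hY
    rw [traceFamily_matrixFun]
    exact Algebra.subset_adjoin ⟨g, rfl⟩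
  | zero => rw [map_zero]; exact Subalgebra.zero_mem _
  | add Y Z _ _ hY hZ => rw [map_add]; exact Subalgebra.add_mem _ hY hZ
  | smul c Y _ hY => rw [map_smul]; exact Subalgebra.smul_mem _ hY c

/-- Trace 2 and determinant 1 make `A - 1` singular, so words without repetition in the finitely
many arcs suffice. -/
theorem coordinateRing_fg : D.coordinateRing.FG := by
  have hfin : {l : List D.Arc | l.Nodup}.Finite := by
    have := Fintype.ofFinite D.Arc
    refine (List.finite_length_le D.Arc (Fintype.card D.Arc)).subset fun l hl => ?_
    exact List.Nodup.length_le_card hl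
  refine Subalgebra.fg_def.2 ⟨_, hfin.image fun l => traceFamily D.Xpar
    (l.map fun i => D.matrixFun (D.meridian i) - 1).prod, le_antisymm ?_ ?_⟩
  · refine Algebra.adjoin_le ?_
    rintro _ ⟨l, -, rfl⟩
    exact D.traceFamily_mem_coordinateRing l
  · refine Algebra.adjoin_le ?_
    rintro _ ⟨g, rfl⟩
    rw [← traceFamily_matrixFun]
    refine traceFamily_mem_adjoin _ (fun i χ => ?_) (D.matrixFun_mem_adjoin g)
    have ht := χ.out.2.1 i
    have hd := (χ.out.1 (D.meridian i)).2
    rw [Matrix.trace_fin_two] at ht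
    rw [Matrix.det_fin_two] at hd
    change ((χ.out.1 (D.meridian i)).1 - 1).det = 0
    rw [Matrix.det_fin_two]
    simp
    linear_combination hd - ht

theorem finite_Xpar (hdim : D.XparZeroDimensional) : Finite D.Xpar := by
  have : Algebra.FiniteType ℂ D.coordinateRing :=
    Subalgebra.fg_iff_finiteType _ |>.1 D.coordinateRing_fg
  have : IsNoetherianRing D.coordinateRing := Algebra.FiniteType.isNoetherianRing ℂ _
  have : Ring.KrullDimLE 0 D.coordinateRing := Ring.krullDimLE_iff.2 hdim
  have : IsArtinianRing D.coordinateRing :=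
    isArtinianRing_iff_isNoetherianRing_krullDimLE_zero.2 ⟨inferInstance, inferInstance⟩
  -- The kernel of evaluation at `χ` contains `f - f(χ)` for each trace function `f`, so it
  -- determines the character.
  let ev : D.Xpar → D.coordinateRing →ₐ[ℂ] ℂ := fun χ =>
    (Pi.evalAlgHom ℂ (fun _ => ℂ) χ).comp D.coordinateRing.val
  refine Finite.of_injective (β := PrimeSpectrum D.coordinateRing)
    (fun χ => ⟨RingHom.ker (ev χ), RingHom.ker_isPrime _⟩) ?_
  intro χ ψ h
  have hker : RingHom.ker (ev χ) = RingHom.ker (ev ψ) := congrArg PrimeSpectrum.asIdeal h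
  have htr : ∀ g, D.traceFun g χ = D.traceFun g ψ := by
    intro g
    let f : D.coordinateRing := ⟨D.traceFun g, Algebra.subset_adjoin ⟨g, rfl⟩⟩
    have hf : f - algebraMap ℂ _ (D.traceFun g χ) ∈ RingHom.ker (ev χ) := by
      rw [RingHom.mem_ker, map_sub, AlgHom.commutes]
      exact sub_self _
    rw [hker, RingHom.mem_ker, map_sub, AlgHom.commutes] at hf
    exact (sub_eq_zero.1 hf).symm
  induction χ using Quotient.ind
  induction ψ using Quotient.ind
  exact Quotient.sound htr

end KnotDiagram

/-! ### The fixed field of the automorphisms of `ℂ` -/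

theorem IsAlgClosed.exists_algEquiv_of_isTranscendenceBasis {R K L ι κ : Type*} [CommRing R]
    [IsDomain R] [Field K] [Field L] [IsAlgClosed K] [IsAlgClosed L] [Algebra R K] [Algebra R L]
    {v : ι → K} {w : κ → L} (e : ι ≃ κ) (hv : IsTranscendenceBasis R v)
    (hw : IsTranscendenceBasis R w) : Nonempty (K ≃ₐ[R] L) := by
  refine ⟨AlgEquiv.ofRingEquiv (f := IsAlgClosed.equivOfTranscendenceBasis v w e hv hw) ?_⟩
  intro r
  let := IsAlgClosed.isAlgClosure_of_transcendence_basis v hv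
  rw [IsScalarTower.algebraMap_apply R (Algebra.adjoin R (Set.range v)) K]
  unfold IsAlgClosed.equivOfTranscendenceBasis
  dsimp only
  erw [IsAlgClosure.equivOfEquiv_algebraMap]
  simp

open Cardinal in
/-- Two embeddings of a countable domain into `ℂ` differ by an automorphism of `ℂ`. -/
theorem Complex.exists_ringEquiv_comp_eq {R : Type} [CommRing R] [IsDomain R] [Countable R]
    (f g : R →+* ℂ) (hf : Function.Injective f) (hg : Function.Injective g) :
    ∃ σ : ℂ ≃+* ℂ, ∀ r, σ (f r) = g r := by
  -- Over a countable base every transcendence basis of `ℂ` has the cardinality of `ℂ`, so the bases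
  -- for the two algebra structures can be matched.
  have basis : ∀ h : R →+* ℂ, Function.Injective h →
      ∃ s : Set ℂ, @IsTranscendenceBasis s R ℂ _ _ h.toAlgebra Subtype.val ∧
        #s = #ℂ := by
    intro h hh
    let := h.toAlgebra
    have : FaithfulSMul R ℂ := (faithfulSMul_iff_algebraMap_injective R ℂ).2 hh
    obtain ⟨s, hs⟩ := exists_isTranscendenceBasis R ℂ
    refine ⟨s, hs, ?_⟩
    rw [IsAlgClosed.cardinal_eq_cardinal_transcendence_basis_of_aleph0_lt' _ hs
      (Cardinal.mk_le_aleph0) (by rw [Cardinal.mk_complex]; exact Cardinal.aleph0_lt_continuum)]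
  obtain ⟨s, hs, hs'⟩ := basis f hf
  obtain ⟨t, ht, ht'⟩ := basis g hg
  obtain ⟨e⟩ := Cardinal.eq.1 (hs'.trans ht'.symm)
  obtain ⟨σ⟩ := @IsAlgClosed.exists_algEquiv_of_isTranscendenceBasis R ℂ ℂ s t _ _ _ _ _ _
    f.toAlgebra g.toAlgebra _ _ e hs ht
  refine ⟨@AlgEquiv.toRingEquiv R ℂ ℂ _ _ _ f.toAlgebra g.toAlgebra σ, fun r => ?_⟩
  exact @AlgEquiv.commutes R ℂ ℂ _ _ _ f.toAlgebra g.toAlgebra σ r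

theorem Polynomial.countable_rat : Countable (Polynomial ℚ) :=
  Cardinal.mk_le_aleph0_iff.1 (Polynomial.cardinalMk_le_max.trans (by simp))

/-- A complex number that is fixed by all automorphisms of `ℂ` is rational. -/
theorem Complex.mem_range_algebraMap_rat_of_forall_ringEquiv (x : ℂ)
    (hx : ∀ σ : ℂ ≃+* ℂ, σ x = x) : x ∈ (algebraMap ℚ ℂ).range := by
  by_cases hal : IsAlgebraic ℚ x
  · have hint : IsIntegral ℚ x := hal.isIntegral
    have hirr := minpoly.irreducible hint
    have : Fact (Irreducible (minpoly ℚ x)) := ⟨hirr⟩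
    -- An automorphism extends `ℚ(x) ≃ ℚ(y)` for each conjugate `y`; as `x` is fixed, it is the only
    -- root, and separability makes the degree 1.
    have hroots : ∀ y ∈ (minpoly ℚ x).rootSet ℂ, y = x := by
      intro y hy
      have hy' : Polynomial.eval₂ (algebraMap ℚ ℂ) y (minpoly ℚ x) = 0 :=
        Polynomial.aeval_eq_zero_of_mem_rootSet hy
      have hx' : Polynomial.eval₂ (algebraMap ℚ ℂ) x (minpoly ℚ x) = 0 := minpoly.aeval ℚ x
      have := Polynomial.countable_rat
      have : Countable (AdjoinRoot (minpoly ℚ x)) := AdjoinRoot.mk_surjective.countable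
      obtain ⟨σ, hσ⟩ := Complex.exists_ringEquiv_comp_eq
        (AdjoinRoot.lift (algebraMap ℚ ℂ) x hx') (AdjoinRoot.lift (algebraMap ℚ ℂ) y hy')
        (RingHom.injective _) (RingHom.injective _)
      have h := hσ (AdjoinRoot.root _)
      rw [AdjoinRoot.lift_root, AdjoinRoot.lift_root, hx] at h
      exact h.symm
    have hcard := Polynomial.card_rootSet_eq_natDegree (K := ℂ) hirr.separable
      (IsAlgClosed.splits _)
    have hle : Fintype.card ((minpoly ℚ x).rootSet ℂ) ≤ 1 :=
      Fintype.card_le_one_iff.2 fun a b => Subtype.ext <|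
        (hroots a a.2).trans (hroots b b.2).symm
    have hdeg : (minpoly ℚ x).degree = 1 := by
      have := minpoly.natDegree_pos hint
      rw [Polynomial.degree_eq_natDegree hirr.ne_zero]
      have : (minpoly ℚ x).natDegree = 1 := by omega
      rw [this]; rfl
    exact minpoly.mem_range_of_degree_eq_one ℚ x hdeg
  · exfalso
    -- A transcendental `x` is moved to `x + 1`, by comparing the two evaluations of `ℚ[X]`.
    have key : ∀ y : ℂ, Transcendental ℚ y →
        Function.Injective (Polynomial.aeval (R := ℚ) y).toRingHom := fun y hy =>
      transcendental_iff_injective.1 hy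
    have hx1 : Transcendental ℚ (x + 1) := fun h =>
      hal (by simpa using h.sub (isAlgebraic_one (R := ℚ)))
    have := Polynomial.countable_rat
    obtain ⟨σ, hσ⟩ := Complex.exists_ringEquiv_comp_eq _ _ (key x hal) (key _ hx1)
    have h := hσ Polynomial.X
    simp [hx] at h

theorem Polynomial.exists_map_algebraMap_rat_eq (p : Polynomial ℂ)
    (hp : ∀ σ : ℂ ≃+* ℂ, p.map (σ : ℂ →+* ℂ) = p) :
    ∃ g : Polynomial ℚ, g.map (algebraMap ℚ ℂ) = p := by
  have : p ∈ Polynomial.lifts (algebraMap ℚ ℂ) := by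
    rw [Polynomial.lifts_iff_coeff_lifts]
    intro n
    refine Complex.mem_range_algebraMap_rat_of_forall_ringEquiv _ fun σ => ?_
    conv_rhs => rw [← hp σ, Polynomial.coeff_map]
    rfl
  exact (Polynomial.mem_lifts _).1 this

/-- If `X_par` is zero-dimensional, then it is finite, the `u`-values of a fixed sign-type are
well defined on it (every point is represented by a coloring of that sign-type, and all such
colorings give the same number), and the `u`-polynomial has rational coefficients. -/
theorem mainTheorem3 (D : KnotDiagram) (hdim : D.XparZeroDimensional)
    (ε : D.SignTypePair) (i j : D.Arc) :
    Finite D.Xpar ∧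
    (∀ χ : D.Xpar, (∃ a ∈ D.coloringsOfType ε, D.Represents a χ) ∧
      ∀ a ∈ D.coloringsOfType ε, D.Represents a χ →
        D.uValue ε i j χ = bracket (a i) (a j)) ∧
    ∃ g : Polynomial ℚ, g.map (algebraMap ℚ ℂ) = D.uPolynomial ε i j := by
  have hfin := D.finite_Xpar hdim
  refine ⟨hfin, fun χ => ⟨KnotDiagram.exists_mem_coloringsOfType_represents ε χ,
    fun a hae ha => KnotDiagram.uValue_eq hae ha i j⟩, ?_⟩
  exact Polynomial.exists_map_algebraMap_rat_eq _ fun σ => KnotDiagram.map_uPolynomial σ ε i j
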